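/- **Setting.** Let $m\ge 1$, $n\ge 0$. For $i=1,\dots,m$ let $f_i:\mathbb R^n\to\mathbb R$ be differentiable and $\mu_i$-strongly convex, i.e. $\mu_i>0$ and $f_i(v)\ge f_i(u)+\langle\nabla f_i(u),v-u\rangle+\frac{\mu_i}{2}\|v-u\|^2$ for all $u,v$, with $L_i$-Lipschitz gradient ($L_i \ge 0$), and let $g_i:\mathbb R^n\to(-\infty,+\infty]$ be closed proper convex. Let $L\in\mathbb R^{m\times m}$ be a gossip matrix of an undirected connected graph $\mathcal G$ on $\{1,\dots,m\}$: $L$ is symmetric and positive semidefinite, $\operatorname{Null}(L)=\operatorname{Span}\{\mathbf 1_m\}$, and $L_{ij}\ne0$ only if $i=j$ or $(i,j)$ is an edge. Put $W=L\otimes I_n$, $B=\begin{pmatrix}I_{mn}\\ W\end{pmatrix}\in\mathbb R^{2mn\times mn}$, $F(x)=\sum_{i=1}^m f_i(x_i)$ for $x=(x_1,\dots,x_m)\in\mathbb R^{mn}$ and, for $y=(y_1,\dots,y_{2m})\in\mathbb R^{2mn}$, $G(y)=\sum_{i=1}^m g_i(y_i)$ if $y_{m+1}=\dots=y_{2m}=0$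 and $G(y)=+\infty$ otherwise. Consider the consensus problem $$\min_{x,y}\ F(x)+G(y)\quad\text{s.t. } Bx=y \tag{P}$$ and its dual $$\min_{\lambda\in\mathbb R^{2mn}}\ F^*(B^T\lambda)+G^*(-\lambda), \tag{D}$$ where $p^*(v)=\sup_x\{\langle x,v\rangle-p(x)\}$; an optimal solution of either problem is a minimizer at which the objective is $<+\infty$. **Algorithm.** Let $\mu=\min_i\mu_i$, $\sigma_k>0$ with $\sigma_k\to+\infty$, $\epsilon_k\ge0$ with $\sum_{k=0}^\infty\epsilon_k<+\infty$, and for $\sigma>0$ let $$L_\sigma(x,y;\lambda)=F(x)+G(y)+\tfrac{\sigma}{2}\big\|Bx-y-\tfrac1\sigma\lambda\big\|^2-\tfrac1{2\sigma}\|\lambda\|^2 .$$ Starting from $(x^0,y^0,\lambda^0)$ with $y^0\in\operatorname{dom}G$, let $\{(x^k,y^k,\lambda^k)\}$ be any infinite sequence such that for every $k\ge0$, with $\phi_k(x):=\min_yL_{\sigma_k}(x,y;\lambda^k)$, $$\text{(A}'\text{)}\quad \|\nabla\phi_k(x^{k+1})\|^2\le\frac{\epsilon_k^2\,\mu}{\sigma_k},\qquad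 y^{k+1}=\operatorname{Prox}_{\frac1{\sigma_k}G}\big(Bx^{k+1}-\tfrac1{\sigma_k}\lambda^k\big),\qquad \lambda^{k+1}=\lambda^k-\sigma_k(Bx^{k+1}-y^{k+1}),$$ where $\operatorname{Prox}_p(v)=\operatorname{argmin}_y\{p(y)+\frac12\|y-v\|^2\}$. **Theorem (global convergence of the ALM).** Suppose that the solution set of (P) is nonempty and that $\bigcap_{i=1}^m\operatorname{ri}(\operatorname{dom}g_i)\ne\emptyset$ (equivalently, some $x$ satisfies $Bx\in\operatorname{ri}(\operatorname{dom}G)$). Then (P) has a unique optimal solution $(x^*,y^*)$, the sequence $\{(x^k,y^k)\}$ converges to $(x^*,y^*)$, and $\{\lambda^k\}$ converges to an optimal solution $\lambda^*$ of (D). -/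

import Mathlib

open Filter Topology

noncomputable section

namespace ConsensusALM

/-! ### Convex analysis for extended-real-valued functions -/

section ConvexAnalysis

variable {E : Type*} [NormedAddCommGroup E] [InnerProductSpace ℝ E]

/-- The effective domain of an extended-real-valued function. -/
def effDomain (p : E → EReal) : Set E := {x | p x < ⊤}

/-- A closed proper convex function: it never takes the value `-∞`, is not identically `+∞`,
is lower semicontinuous, and has a convex epigraph. -/
structure IsClosedProperConvex (p : E → EReal) : Prop where
  ne_bot : ∀ x, p x ≠ ⊥
  nonempty_dom : (effDomain p).Nonempty
  lsc : LowerSemicontinuous p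
  convex_epi : Convex ℝ {q : E × ℝ | p q.1 ≤ (q.2 : EReal)}

/-- The conjugate function `p^*(v) = sup_x (⟨x, v⟩ - p x)`.  Points with `p x = +∞` contribute
`-∞`, so the supremum over the whole space is the supremum over the effective domain. -/
def conjugate (p : E → EReal) (v : E) : EReal :=
  ⨆ x : E, ((inner ℝ x v : ℝ) : EReal) - p x

/-- `Prox_p(v)` as the set of minimizers of `p y + ‖y - v‖² / 2`
(a single point if `p` is closed proper convex on a finite-dimensional space). -/
def proxSet (p : E → EReal) (v : E) : Set E :=
  {y | ∀ z, p y + ((‖y - v‖ ^ 2 / 2 : ℝ) : EReal) ≤ p z + ((‖z - v‖ ^ 2 / 2 : ℝ) : EReal)}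

variable [CompleteSpace E]

/-- `f` is differentiable and strongly convex with convexity parameter `μ > 0`. -/
def IsStronglyConvex (μ : ℝ) (f : E → ℝ) : Prop :=
  0 < μ ∧ Differentiable ℝ f ∧
    ∀ x y, f x + inner ℝ (gradient f x) (y - x) + μ / 2 * ‖y - x‖ ^ 2 ≤ f y

/-- `f` is differentiable with `L`-Lipschitz gradient on the whole space. -/
def IsLSmooth (L : ℝ) (f : E → ℝ) : Prop :=
  0 ≤ L ∧ Differentiable ℝ f ∧ ∀ x y, ‖gradient f x - gradient f y‖ ≤ L * ‖x - y‖

end ConvexAnalysis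

/-! ### The consensus problem -/

/-- A gossip matrix of the (undirected) graph `𝒢`. -/
structure IsGossipMatrix {m : ℕ} (𝒢 : SimpleGraph (Fin m)) (L : Matrix (Fin m) (Fin m) ℝ) :
    Prop where
  symm : L.transpose = L
  posSemidef : L.PosSemidef
  null_eq : LinearMap.ker L.mulVecLin = Submodule.span ℝ {(fun _ => 1 : Fin m → ℝ)}
  graph_induced : ∀ i j, L i j ≠ 0 → i = j ∨ 𝒢.Adj i j

/-- The space `ℝⁿ` of a single agent. -/
abbrev Agent (n : ℕ) : Type := EuclideanSpace ℝ (Fin n)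

/-- The space `ℝ^{mn}` of stacked vectors `x = (x_1, …, x_m)`. -/
abbrev Stack (m n : ℕ) : Type := EuclideanSpace ℝ (Fin m × Fin n)

/-- The space `ℝ^{2mn}`: `Sum.inl` indexes the first `mn` coordinates, `Sum.inr` the last `mn`. -/
abbrev Stack2 (m n : ℕ) : Type := EuclideanSpace ℝ ((Fin m × Fin n) ⊕ (Fin m × Fin n))

/-- The block `x_i ∈ ℝⁿ` of a stacked vector. -/
def block {m n : ℕ} (x : Stack m n) (i : Fin m) : Agent n := WithLp.toLp 2 fun j => x (i, j)

/-- The block `y_i ∈ ℝⁿ`, `1 ≤ i ≤ m`, of a vector of `ℝ^{2mn}`. -/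
def topBlock {m n : ℕ} (y : Stack2 m n) (i : Fin m) : Agent n :=
  WithLp.toLp 2 fun j => y (Sum.inl (i, j))

/-- `W = L ⊗ I_n`. -/
def gossipW {m : ℕ} (n : ℕ) (L : Matrix (Fin m) (Fin m) ℝ) :
    Matrix (Fin m × Fin n) (Fin m × Fin n) ℝ :=
  Matrix.kronecker L (1 : Matrix (Fin n) (Fin n) ℝ)

/-- The matrix `B`, with `I_{mn}` stacked on top of `W`. -/
def matB {m : ℕ} (n : ℕ) (L : Matrix (Fin m) (Fin m) ℝ) :
    Matrix ((Fin m × Fin n) ⊕ (Fin m × Fin n)) (Fin m × Fin n) ℝ :=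
  Matrix.fromRows 1 (gossipW n L)

/-- `x ↦ B x`. -/
def opB {m : ℕ} (n : ℕ) (L : Matrix (Fin m) (Fin m) ℝ) : Stack m n →ₗ[ℝ] Stack2 m n :=
  Matrix.toEuclideanLin (matB n L)

/-- `λ ↦ Bᵀ λ`. -/
def opBT {m : ℕ} (n : ℕ) (L : Matrix (Fin m) (Fin m) ℝ) : Stack2 m n →ₗ[ℝ] Stack m n :=
  Matrix.toEuclideanLin (matB n L).transpose

/-- `F(x) = ∑ i, f_i(x_i)`. -/
def objF {m n : ℕ} (f : Fin m → Agent n → ℝ) (x : Stack m n) : ℝ := ∑ i, f i (block x i)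

open Classical in
/-- `G(y) = ∑ i, g_i(y_i)` on the vectors `y = (y_1, …, y_m, 0, …, 0)`, and `+∞` on the vectors of
`ℝ^{2mn}` that are not of this form. -/
def objG {m n : ℕ} (g : Fin m → Agent n → EReal) (y : Stack2 m n) : EReal :=
  (∑ i, g i (topBlock y i)) + if ∀ r, y (Sum.inr r) = 0 then 0 else ⊤

/-- `(x, y)` is an optimal solution (with finite value) of `min F(x) + G(y)` s.t. `B x = y`. -/
def IsPrimalSolution {m n : ℕ} (f : Fin m → Agent n → ℝ) (g : Fin m → Agent n → EReal)
    (L : Matrix (Fin m) (Fin m) ℝ) (x : Stack m n) (y : Stack2 m n) : Prop :=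
  opB n L x = y ∧ (objF f x : EReal) + objG g y < ⊤ ∧
    ∀ x' y', opB n L x' = y' → (objF f x : EReal) + objG g y ≤ (objF f x' : EReal) + objG g y'

/-- The dual objective `H(λ) = F^*(Bᵀ λ) + G^*(-λ)`. -/
def dualH {m n : ℕ} (f : Fin m → Agent n → ℝ) (g : Fin m → Agent n → EReal)
    (L : Matrix (Fin m) (Fin m) ℝ) (lam : Stack2 m n) : EReal :=
  conjugate (fun x => (objF f x : EReal)) (opBT n L lam) + conjugate (objG g) (-lam)

/-- `λ` is an optimal solution (with finite value) of the dual problem `min H(λ)`. -/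
def IsDualSolution {m n : ℕ} (f : Fin m → Agent n → ℝ) (g : Fin m → Agent n → EReal)
    (L : Matrix (Fin m) (Fin m) ℝ) (lam : Stack2 m n) : Prop :=
  dualH f g L lam < ⊤ ∧ ∀ lam', dualH f g L lam ≤ dualH f g L lam'

/-! ### The augmented Lagrangian method -/

/-- The augmented Lagrangian
`L_σ(x, y; λ) = F(x) + G(y) + σ/2 ‖B x - y - λ/σ‖² - ‖λ‖²/(2σ)`. -/
def augLagrangian {m n : ℕ} (f : Fin m → Agent n → ℝ) (g : Fin m → Agent n → EReal)
    (L : Matrix (Fin m) (Fin m) ℝ) (σ : ℝ) (x : Stack m n) (y lam : Stack2 m n) : EReal :=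
  (objF f x : EReal) + objG g y +
    ((σ / 2 * ‖opB n L x - y - σ⁻¹ • lam‖ ^ 2 - ‖lam‖ ^ 2 / (2 * σ) : ℝ) : EReal)

/-- The reduced function `φ(x) = min_y L_σ(x, y; λ)`
(for closed proper convex `g_i` and `σ > 0` the minimum is attained and finite). -/
def phi {m n : ℕ} (f : Fin m → Agent n → ℝ) (g : Fin m → Agent n → EReal)
    (L : Matrix (Fin m) (Fin m) ℝ) (σ : ℝ) (lam : Stack2 m n) (x : Stack m n) : ℝ :=
  (⨅ y : Stack2 m n, augLagrangian f g L σ x y lam).toReal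

/-- `(x^k, y^k, λ^k)` is generated by the inexact ALM with penalty parameters `σ_k → +∞`:
`x^{k+1}` is any point satisfying the implementable criterion
`‖∇φ_k(x^{k+1})‖² ≤ ε_k² μ / σ_k`, where `φ_k(x) = min_y L_{σ_k}(x, y; λ^k)`,
`y^{k+1} = Prox_{G/σ_k}(B x^{k+1} - λ^k/σ_k)` and `λ^{k+1} = λ^k - σ_k (B x^{k+1} - y^{k+1})`. -/
structure IsInexactALM {m n : ℕ} (f : Fin m → Agent n → ℝ) (g : Fin m → Agent n → EReal)
    (L : Matrix (Fin m) (Fin m) ℝ) (μ : ℝ) (σ ε : ℕ → ℝ)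
    (x : ℕ → Stack m n) (y lam : ℕ → Stack2 m n) : Prop where
  sigma_pos : ∀ k, 0 < σ k
  sigma_tendsto : Tendsto σ atTop atTop
  eps_nonneg : ∀ k, 0 ≤ ε k
  eps_summable : Summable ε
  init : y 0 ∈ effDomain (objG g)
  criterion : ∀ k, ‖gradient (phi f g L (σ k) (lam k)) (x (k + 1))‖ ^ 2 ≤ ε k ^ 2 * μ / σ k
  prox_step : ∀ k, y (k + 1) ∈
    proxSet (fun y => (((σ k)⁻¹ : ℝ) : EReal) * objG g y)
      (opB n L (x (k + 1)) - (σ k)⁻¹ • lam k)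
  multiplier_step : ∀ k, lam (k + 1) = lam k - σ k • (opB n L (x (k + 1)) - y (k + 1))

end ConsensusALM

end

/-!
Write `γ` for the real values of `G` on its domain `C`. The proof is organised around pairs
`(x*, λ*)` satisfying the optimality conditions `∇F(x*) = Bᵀλ*`, `-λ* ∈ ∂G(B x*)`. They are encoded
in `IsKKT` as two subgradient inequalities, the first one with the strong convexity term of `F`; in
this form they survive limits without any continuity of `∇F` or lower semicontinuity of `G`.

*Existence of a multiplier.* At a minimizer `x*` of `F + G ∘ B`, the linearization of `F` may
replace `F` (`first_order_of_isMin`). The multiplier is then a non-vertical supporting hyperplane at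
the origin of the epigraph of the perturbation function `z ↦ inf_x ⟨∇F(x*), x⟩ + G(B x + z)`. The
constraint qualification says that the domain of this function is absorbing in its linear span,
because `x₀ = (w, …, w)` with `w ∈ ⋂ ri (dom g_i)` satisfies `B x₀ = (x₀, 0)` and every segment of
`C` ending at `B x₀` can be prolonged inside `C`. Riesz extension in that span yields the hyperplane
(`exists_linear_minorant`, `exists_multiplier`).

*The inexactness criterion.* The reduced function `φ_k` is squeezed between two functions that are
differentiable at `x^{k+1}` and touch it there, so it is differentiable at that point with
`∇φ_k(x^{k+1}) = ∇F(x^{k+1}) - Bᵀλ^{k+1}` (`hasFDerivAt_envelope`). Together with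
`-λ^{k+1} ∈ ∂G(y^{k+1})`, which is the optimality of the proximal step, every step solves the
optimality conditions up to an error of norm at most `ε_k √(μ / σ_k)` (`inexact_step`).

*Convergence.* Monotonicity of both subdifferentials gives, for each multiplier `λ*`,
`‖λ^{k+1} - λ*‖² + σ_k μ ‖x^{k+1} - x*‖² + ‖λ^k - λ^{k+1}‖² ≤ ‖λ^k - λ*‖² + ε_k²` (`fejer_step`).
Hence `x^k → x*`, `y^k → B x*`, the sequence `λ^k` is bounded, its cluster points are multipliers
for `x*`, and quasi-Fejér monotonicity with respect to one cluster point turns subsequential into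
full convergence (`tendsto_of_inexact_steps`). Finally, the optimality conditions give the
uniqueness of `x*` and, through weak duality, the optimality of the multiplier for the dual problem.
-/

namespace ConsensusALM

/-! ### Supporting hyperplanes and Lagrange multipliers -/

section Multipliers

/-- A convex set `K ⊆ V × ℝ` that meets the vertical axis only at nonnegative heights has a
non-vertical supporting hyperplane at the origin, provided its projection to `V` is absorbing in its
linear span. The last condition is expressed by `hcore`: with every point, the projection contains a
positive multiple of the opposite point. -/
theorem exists_linear_minorant {V : Type*} [AddCommGroup V] [Module ℝ V] {K : Set (V × ℝ)}
    (hK : Convex ℝ K) (hpos : ∀ t, ((0 : V), t) ∈ K → 0 ≤ t) (hzero : ∃ t, ((0 : V), t) ∈ K)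
    (hcore : ∀ p ∈ K, ∃ c : ℝ, 0 < c ∧ ∃ t, (-(c • p.1), t) ∈ K) :
    ∃ l : V →ₗ[ℝ] ℝ, ∀ p ∈ K, l p.1 ≤ p.2 := by
  set S : Submodule ℝ V := Submodule.span ℝ (Prod.fst '' K) with hS
  have absorb : ∀ z ∈ S, ∃ c : ℝ, 0 < c ∧ ∃ t, (c • z, t) ∈ K := by
    intro z hz
    induction hz using Submodule.span_induction with
    | mem z hz =>
      obtain ⟨p, hp, rfl⟩ := hz
      exact ⟨1, one_pos, p.2, by simpa using hp⟩
    | zero =>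
      obtain ⟨t, ht⟩ := hzero
      exact ⟨1, one_pos, t, by simpa using ht⟩
    | add z₁ z₂ _ _ h₁ h₂ =>
      obtain ⟨c₁, hc₁, t₁, h₁⟩ := h₁
      obtain ⟨c₂, hc₂, t₂, h₂⟩ := h₂
      have hc : 0 < c₁ + c₂ := by positivity
      refine ⟨c₁ * c₂ / (c₁ + c₂), by positivity,
        c₂ / (c₁ + c₂) * t₁ + c₁ / (c₁ + c₂) * t₂, ?_⟩
      · have := hK h₁ h₂ (a := c₂ / (c₁ + c₂)) (b := c₁ / (c₁ + c₂)) (by positivity)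
          (by positivity) (by field_simp; ring)
        convert this using 1
        ext
        · simp only [Prod.smul_mk, Prod.mk_add_mk, smul_smul, smul_add]
          congr 2 <;> ring
        · simp
    | smul a z _ h =>
      obtain ⟨c, hc, t, h⟩ := h
      rcases lt_trichotomy a 0 with ha | rfl | ha
      · obtain ⟨e, he, t', h'⟩ := hcore _ h
        refine ⟨e * c / (-a), div_pos (by positivity) (by linarith), t', ?_⟩
        convert h' using 2
        rw [smul_smul, smul_smul, ← neg_smul]
        congr 1
        rw [div_mul_eq_mul_div, div_neg, mul_div_assoc, div_self ha.ne, mul_one]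
      · obtain ⟨t, ht⟩ := hzero
        exact ⟨1, one_pos, t, by simpa using ht⟩
      · refine ⟨c / a, by positivity, t, ?_⟩
        rwa [smul_smul, div_mul_cancel₀ _ ha.ne']
  let K' : Set (S × ℝ) := (S.subtype.prodMap (LinearMap.id : ℝ →ₗ[ℝ] ℝ)) ⁻¹' K
  have hK' : Convex ℝ K' := hK.linear_preimage _
  have hK'ne : K'.Nonempty := by
    obtain ⟨t, ht⟩ := hzero
    exact ⟨(0, t), by simpa [K'] using ht⟩
  let cone : PointedCone ℝ (S × ℝ) :=
    { carrier := {p | ∃ c : ℝ, 0 ≤ c ∧ ∃ q ∈ K', c • q = p}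
      zero_mem' := by
        obtain ⟨q, hq⟩ := hK'ne
        exact ⟨0, le_rfl, q, hq, zero_smul _ _⟩
      smul_mem' := by
        rintro ⟨r, hr⟩ _ ⟨c, hc, q, hq, rfl⟩
        exact ⟨r * c, by positivity, q, hq, mul_smul r c q⟩
      add_mem' := by
        rintro _ _ ⟨c₁, hc₁, q₁, hq₁, rfl⟩ ⟨c₂, hc₂, q₂, hq₂, rfl⟩
        rcases (add_nonneg hc₁ hc₂).eq_or_lt with h | h
        · have h₁ : c₁ = 0 := by linarith
          have h₂ : c₂ = 0 := by linarith
          exact ⟨0, le_rfl, q₁, hq₁, by simp [h₁, h₂]⟩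
        · refine ⟨c₁ + c₂, h.le, _, convex_iff_div.1 hK' hq₁ hq₂ hc₁ hc₂ h, ?_⟩
          simp only [smul_add, smul_smul, mul_div_cancel₀ _ h.ne'] }
  -- Riesz extension applies to the functional `(0, t) ↦ t` on the vertical axis of `S × ℝ` and the
  -- cone generated by `K`; the axis is cofinal for this cone since the projection of `K` absorbs
  -- `S`.
  let vert : S × ℝ →ₗ.[ℝ] ℝ :=
    ⟨LinearMap.range (LinearMap.inr ℝ S ℝ), (LinearMap.snd ℝ S ℝ).domRestrict _⟩
  obtain ⟨φ, hφ, hφK⟩ := riesz_extension cone vert (by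
    rintro ⟨_, t, rfl⟩ hx
    obtain ⟨c, hc, y, hy, hyx⟩ := hx
    have h2 : c * y.2 = t := by simpa using congrArg Prod.snd hyx
    change 0 ≤ t
    rcases hc.eq_or_lt with rfl | hc
    · simp [← h2]
    have h1 : y.1 = 0 := by
      have := congrArg Prod.fst hyx
      simpa [hc.ne'] using this
    have h3 : 0 ≤ y.2 := hpos _ (by
      have h4 : ((y.1 : V), y.2) ∈ K := hy
      rwa [h1] at h4)
    rw [← h2]; positivity) (by
    rintro ⟨z, s⟩
    obtain ⟨c, hc, t, h⟩ := absorb z z.2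
    refine ⟨⟨((0 : S), c⁻¹ * t - s), c⁻¹ * t - s, rfl⟩, ⟨c⁻¹, by positivity,
      (c • z, t), h, ?_⟩⟩
    ext
    · simp [smul_smul, hc.ne']
    · simp)
  obtain ⟨l, hl⟩ := LinearMap.exists_extend (-(φ ∘ₗ LinearMap.inl ℝ S ℝ))
  refine ⟨l, fun p hp => ?_⟩
  have hpS : p.1 ∈ S := Submodule.subset_span ⟨p, hp, rfl⟩
  have h1 : l p.1 = -φ (⟨p.1, hpS⟩, 0) := by
    simpa using LinearMap.congr_fun hl ⟨p.1, hpS⟩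
  have h2 : φ (0, p.2) = p.2 := hφ ⟨((0 : S), p.2), p.2, rfl⟩
  have h3 : 0 ≤ φ (⟨p.1, hpS⟩, p.2) :=
    hφK _ ⟨1, zero_le_one, (⟨p.1, hpS⟩, p.2), hp, one_smul _ _⟩
  have h4 : ((⟨p.1, hpS⟩, p.2) : S × ℝ) = (⟨p.1, hpS⟩, 0) + (0, p.2) := by simp
  rw [h4, map_add, h2] at h3
  linarith

variable {X Y : Type*} [NormedAddCommGroup X] [InnerProductSpace ℝ X]
  [NormedAddCommGroup Y] [InnerProductSpace ℝ Y]

/-- At a minimizer of `F + γ ∘ B` with `γ` convex, the differentiable term `F` may be replaced by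
its linearization. -/
theorem first_order_of_isMin {C : Set Y} {γ : Y → ℝ} (hγ : ConvexOn ℝ C γ) (B : X →ₗ[ℝ] Y)
    {F : X → ℝ} {F' : X →L[ℝ] ℝ} {xs : X} (hF : HasFDerivAt F F' xs) (hxs : B xs ∈ C)
    (hmin : ∀ x, B x ∈ C → F xs + γ (B xs) ≤ F x + γ (B x)) {x : X} (hx : B x ∈ C) :
    F' xs + γ (B xs) ≤ F' x + γ (B x) := by
  have hlim : Tendsto (fun t : ℝ => t⁻¹ • (F (xs + t • (x - xs)) - F xs)) (𝓝[>] 0)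
      (𝓝 (F' (x - xs))) := (hF.hasLineDerivAt (x - xs)).tendsto_slope_zero_right
  have key : ∀ᶠ t : ℝ in 𝓝[>] 0,
      γ (B xs) - γ (B x) ≤ t⁻¹ • (F (xs + t • (x - xs)) - F xs) := by
    filter_upwards [Ioc_mem_nhdsGT (zero_lt_one (α := ℝ))] with t (ht : 0 < t ∧ t ≤ 1)
    have hcomb : B (xs + t • (x - xs)) = (1 - t) • B xs + t • B x := by
      simp only [map_add, map_smul, map_sub]; module
    have hmem : (1 - t) • B xs + t • B x ∈ C :=
      hγ.1 hxs hx (by linarith [ht.2]) ht.1.le (by ring)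
    have h1 := hmin (xs + t • (x - xs)) (by rwa [hcomb])
    have h2 := hγ.2 hxs hx (show 0 ≤ 1 - t by linarith [ht.2]) ht.1.le (by ring)
    rw [hcomb] at h1
    simp only [smul_eq_mul] at h2 ⊢
    rw [inv_mul_eq_div, le_div_iff₀ ht.1]
    linarith
  have := ge_of_tendsto hlim key
  rw [map_sub] at this
  linarith

/-- Fenchel duality for a linear function `a` and a convex function `γ ∘ B`: if `xs` is a minimizer
of `a + γ ∘ B`, then `a = Bᵀ l` with `-l` a subgradient of `γ` at `B xs`. The qualification `hcore`
holds in particular if `B x₀` is in the relative interior of `C`. -/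
theorem exists_multiplier [FiniteDimensional ℝ Y] {C : Set Y} {γ : Y → ℝ}
    (hγ : ConvexOn ℝ C γ) (B : X →ₗ[ℝ] Y)
    (a : X →ₗ[ℝ] ℝ) {xs : X} (hxs : B xs ∈ C)
    (hmin : ∀ x, B x ∈ C → a xs + γ (B xs) ≤ a x + γ (B x))
    {x₀ : X} (hcore : ∀ y ∈ C, ∃ c : ℝ, 0 < c ∧ B x₀ - c • (y - B x₀) ∈ C) :
    ∃ l : Y, (∀ x, a x = inner ℝ l (B x)) ∧
      ∀ z ∈ C, γ (B xs) - inner ℝ l (z - B xs) ≤ γ z := by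
  -- The epigraph of the perturbation function `z ↦ inf_x a x + γ (B x + z)`, lowered by its value
  -- at `0`.
  let K : Set (Y × ℝ) :=
    {p | ∃ x, B x + p.1 ∈ C ∧ a x + γ (B x + p.1) - a xs - γ (B xs) ≤ p.2}
  have hK : Convex ℝ K := by
    rintro ⟨z₁, t₁⟩ ⟨x₁, h₁, h₁'⟩ ⟨z₂, t₂⟩ ⟨x₂, h₂, h₂'⟩ u v hu hv huv
    have hcomb : B (u • x₁ + v • x₂) + (u • z₁ + v • z₂) =
        u • (B x₁ + z₁) + v • (B x₂ + z₂) := by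
      simp only [map_add, map_smul]; module
    refine ⟨u • x₁ + v • x₂, ?_, ?_⟩
    · change B (u • x₁ + v • x₂) + (u • z₁ + v • z₂) ∈ C
      rw [hcomb]
      exact hγ.1 h₁ h₂ hu hv huv
    · change a (u • x₁ + v • x₂) + γ (B (u • x₁ + v • x₂) + (u • z₁ + v • z₂)) - a xs - γ (B xs)
        ≤ u * t₁ + v * t₂
      rw [hcomb]
      have h3 := hγ.2 h₁ h₂ hu hv huv
      simp only [smul_eq_mul, map_add, map_smul] at h3 ⊢
      have h4 := mul_le_mul_of_nonneg_left h₁' hu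
      have h5 := mul_le_mul_of_nonneg_left h₂' hv
      simp only at h4 h5
      have hv' : v = 1 - u := by linarith
      subst hv'
      linarith
  obtain ⟨l, hl⟩ := exists_linear_minorant hK
    (by
      rintro t ⟨x, hx, ht⟩
      simp only [add_zero] at hx ht
      linarith [hmin x hx])
    ⟨0, xs, by simpa using hxs, by simp⟩
    (by
      rintro ⟨z, t⟩ ⟨x, hx, -⟩
      obtain ⟨c, hc, hmem⟩ := hcore _ hx
      refine ⟨c, hc,
        a (x₀ - c • (x - x₀)) + γ (B (x₀ - c • (x - x₀)) + -(c • z)) - a xs - γ (B xs),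
        x₀ - c • (x - x₀), ?_, le_rfl⟩
      convert hmem using 1
      simp only [map_sub, map_smul]
      module)
  have hl' : ∀ x z, B x + z ∈ C → l z ≤ a x + γ (B x + z) - a xs - γ (B xs) :=
    fun x z h => hl (z, _) ⟨x, h, le_rfl⟩
  have : CompleteSpace Y := FiniteDimensional.complete ℝ Y
  set w : Y := -(InnerProductSpace.toDual ℝ Y).symm (LinearMap.toContinuousLinearMap l) with hw
  have hwl : ∀ z, inner ℝ w z = -l z := by
    intro z
    rw [hw, inner_neg_left, InnerProductSpace.toDual_symm_apply]
    rfl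
  -- The perturbation `z = -B d` leaves `γ` at `B xs`; only the linear terms remain, in both
  -- directions.
  have hle : ∀ d, inner ℝ w (B d) ≤ a d := by
    intro d
    have h := hl' (xs + d) (-B d) (by simpa using hxs)
    simp only [map_add, map_neg, add_neg_cancel_right] at h
    rw [hwl]
    linarith
  refine ⟨w, fun d => le_antisymm ?_ (hle d), fun z hz => ?_⟩
  · have := hle (-d)
    simp only [map_neg, inner_neg_right] at this
    linarith
  · have h := hl' xs (z - B xs) (by simpa using hz)
    simp only [add_sub_cancel] at h
    rw [hwl]
    linarith

end Multipliers

/-! ### Proximal steps and the derivative of a Moreau envelope -/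

section Envelope

variable {X Y : Type*} [NormedAddCommGroup X] [InnerProductSpace ℝ X]
  [NormedAddCommGroup Y] [InnerProductSpace ℝ Y]

theorem hasFDerivAt_of_sandwich {φ l u : X → ℝ} {A : X →L[ℝ] ℝ} {x : X}
    (hlφ : ∀ z, l z ≤ φ z) (hφu : ∀ z, φ z ≤ u z) (hx : l x = u x)
    (hl : HasFDerivAt l A x) (hu : HasFDerivAt u A x) : HasFDerivAt φ A x := by
  have hul : HasFDerivAt (fun z => u z - l z) (0 : X →L[ℝ] ℝ) x := by
    have h := hu.sub hl
    rwa [sub_self] at h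
  have hφl : HasFDerivAt (fun z => φ z - l z) (0 : X →L[ℝ] ℝ) x := by
    rw [hasFDerivAt_iff_isLittleO] at hul ⊢
    refine Asymptotics.IsBigO.trans_isLittleO (Asymptotics.IsBigO.of_bound 1 ?_) hul
    refine Eventually.of_forall fun z => ?_
    have h1 : φ x - l x = 0 := by linarith [hlφ x, hφu x]
    have h2 : u x - l x = 0 := by linarith
    simp only [h1, h2, zero_apply, sub_zero, Real.norm_eq_abs, one_mul]
    rw [abs_of_nonneg (by linarith [hlφ z]), abs_of_nonneg (by linarith [hlφ z, hφu z])]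
    linarith [hφu z]
  have := hφl.add hl
  rw [zero_add] at this
  refine this.congr_of_eventuallyEq (Eventually.of_forall fun z => ?_)
  simp

/-- Optimality condition of the proximal step: `σ (v - p)` is a subgradient of `γ` at `p`. -/
theorem subgradient_of_isMin_prox {C : Set Y} {γ : Y → ℝ} (hγ : ConvexOn ℝ C γ) {σ : ℝ}
    {v p : Y} (hp : p ∈ C)
    (hmin : ∀ z ∈ C, γ p + σ / 2 * ‖p - v‖ ^ 2 ≤ γ z + σ / 2 * ‖z - v‖ ^ 2) :
    ∀ z ∈ C, γ p + inner ℝ (σ • (v - p)) (z - p) ≤ γ z := by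
  intro z hz
  have hq : HasFDerivAt (fun z : Y => σ / 2 * ‖z - v‖ ^ 2) (innerSL ℝ (σ • (p - v))) p := by
    have h := (((hasFDerivAt_id p).sub_const v).norm_sq).const_mul (σ / 2)
    refine h.congr_fderiv ?_
    ext w
    simp
    ring
  have h := first_order_of_isMin hγ LinearMap.id hq hp
    (fun w hw => by simpa [add_comm] using hmin w hw) (x := z) hz
  simp only [innerSL_apply_apply, LinearMap.id_apply] at h
  have h2 : inner ℝ (σ • (v - p)) (z - p)
      = inner ℝ (σ • (p - v)) p - inner ℝ (σ • (p - v)) z := by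
    rw [← inner_sub_right, ← neg_sub z p, inner_neg_right, ← inner_neg_left, ← smul_neg, neg_sub]
  linarith

/-- Differentiability of `φ(x) = inf_z F(x) + γ(z) + σ/2 ‖B x - z - b‖² - r` at a point `x` for
which the infimum is attained at `p`. The hypothesis `hφ` requires that `φ` be the infimum only
where the values are bounded below; the subgradient at `p` shows that this is the case everywhere.
-/
theorem hasFDerivAt_envelope [FiniteDimensional ℝ X] {B : X →ₗ[ℝ] Y} {C : Set Y} {γ : Y → ℝ}
    {F φ : X → ℝ} {F' : X →L[ℝ] ℝ} {σ r : ℝ} (hσ : 0 < σ) {b p : Y} {x : X}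
    (hF : HasFDerivAt F F' x) (hp : p ∈ C)
    (hsub : ∀ z ∈ C, γ p + inner ℝ (σ • (B x - b - p)) (z - p) ≤ γ z)
    (hφ : ∀ x', BddBelow ((fun z => F x' + γ z + (σ / 2 * ‖B x' - z - b‖ ^ 2 - r)) '' C) →
      IsGLB ((fun z => F x' + γ z + (σ / 2 * ‖B x' - z - b‖ ^ 2 - r)) '' C) (φ x')) :
    HasFDerivAt φ (F' + (innerSL ℝ (σ • (B x - b - p))).comp (LinearMap.toContinuousLinearMap B))
      x := by
  set s := σ • (B x - b - p) with hs
  have hB : HasFDerivAt (fun x' => B x') (LinearMap.toContinuousLinearMap B) x :=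
    (LinearMap.toContinuousLinearMap B).hasFDerivAt
  -- The lower function results from minimizing over all `z` after `γ` is replaced by its affine
  -- minorant at `p`; the upper one from the choice `z = p`.
  have hlow : ∀ x', F x' + (γ p + inner ℝ s (B x' - b - p) - ‖s‖ ^ 2 / (2 * σ) - r) ∈
      lowerBounds ((fun z => F x' + γ z + (σ / 2 * ‖B x' - z - b‖ ^ 2 - r)) '' C) := by
    rintro x' _ ⟨z, hz, rfl⟩
    have h1 := hsub z hz
    have h2 : 0 ≤ ‖σ • (B x' - z - b) - s‖ ^ 2 := sq_nonneg _
    rw [norm_sub_sq_real, norm_smul, mul_pow, inner_smul_left, Real.norm_eq_abs, sq_abs] at h2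
    have h3 : inner ℝ s (B x' - b - p) = inner ℝ s (z - p) + inner ℝ (B x' - z - b) s := by
      rw [real_inner_comm s, ← inner_add_right]; congr 1; abel
    have h4 : inner ℝ (B x' - z - b) s ≤ σ / 2 * ‖B x' - z - b‖ ^ 2 + ‖s‖ ^ 2 / (2 * σ) := by
      rw [← sub_nonneg]
      have : σ / 2 * ‖B x' - z - b‖ ^ 2 + ‖s‖ ^ 2 / (2 * σ) - inner ℝ (B x' - z - b) s
        = (σ ^ 2 * ‖B x' - z - b‖ ^ 2 - 2 * (σ * inner ℝ (B x' - z - b) s) + ‖s‖ ^ 2)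
          / (2 * σ) := by field_simp; ring
      rw [this]
      exact div_nonneg h2 (by positivity)
    simp only
    linarith
  refine hasFDerivAt_of_sandwich
    (l := fun x' => F x' + (γ p + inner ℝ s (B x' - b - p) - ‖s‖ ^ 2 / (2 * σ) - r))
    (u := fun x' => F x' + (γ p + (σ / 2 * ‖B x' - p - b‖ ^ 2 - r)))
    (fun x' => (hφ x' ⟨_, hlow x'⟩).2 (hlow x')) (fun x' => ?_) ?_ ?_ ?_
  · exact ((hφ x' ⟨_, hlow x'⟩).1 ⟨p, hp, rfl⟩).trans_eq (add_assoc _ _ _)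
  · have h1 : ‖s‖ ^ 2 = σ ^ 2 * ‖B x - b - p‖ ^ 2 := by
      rw [hs, norm_smul, mul_pow, Real.norm_eq_abs, sq_abs]
    have h2 : inner ℝ s (B x - b - p) = σ * ‖B x - b - p‖ ^ 2 := by
      rw [hs, inner_smul_left, real_inner_self_eq_norm_sq]; simp
    have h3 : B x - p - b = B x - b - p := by abel
    simp only [h1, h2, h3]
    field_simp
    ring
  · refine hF.add ?_
    have h := ((hasFDerivAt_const s x).inner ℝ ((hB.sub_const b).sub_const p))
    have h' := ((h.const_add (γ p)).sub_const (‖s‖ ^ 2 / (2 * σ))).sub_const r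
    refine h'.congr_fderiv ?_
    ext w
    simp
  · refine hF.add ?_
    have h := ((((hB.sub_const p).sub_const b).norm_sq.const_mul (σ / 2)).sub_const r).const_add
      (γ p)
    refine h.congr_fderiv ?_
    ext w
    simp [hs, sub_right_comm]
    ring

end Envelope

/-! ### Quasi-Fejér monotonicity and convergence -/

section Convergence

theorem tendsto_zero_of_norm_sq {E : Type*} [NormedAddCommGroup E] {u : ℕ → E}
    (hu : Tendsto (fun k => ‖u k‖ ^ 2) atTop (𝓝 0)) : Tendsto u atTop (𝓝 0) := by
  rw [tendsto_zero_iff_norm_tendsto_zero]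
  simpa using hu.sqrt

/-- Scalar form of quasi-Fejér monotonicity with summable errors `e`. -/
theorem tendsto_of_quasi_fejer {a b e : ℕ → ℝ} (ha : ∀ k, 0 ≤ a k) (hb : ∀ k, 0 ≤ b k)
    (he : ∀ k, 0 ≤ e k) (hsum : Summable e) (h : ∀ k, a (k + 1) + b k ≤ a k + e k) :
    (∃ c, Tendsto a atTop (𝓝 c)) ∧ Tendsto b atTop (𝓝 0) := by
  set s : ℕ → ℝ := fun k => a k - ∑ j ∈ Finset.range k, e j with hs
  have hanti : Antitone s := antitone_nat_of_succ_le fun k => by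
    simp only [hs, Finset.sum_range_succ]
    linarith [h k, hb k]
  have hbdd : BddBelow (Set.range s) := by
    refine ⟨-∑' j, e j, ?_⟩
    rintro _ ⟨k, rfl⟩
    have := hsum.sum_le_tsum (Finset.range k) (fun j _ => he j)
    simp only [hs]
    linarith [ha k]
  have hlim := (tendsto_atTop_ciInf hanti hbdd).add hsum.hasSum.tendsto_sum_nat
  have hlim' : Tendsto a atTop (𝓝 ((⨅ k, s k) + ∑' j, e j)) :=
    hlim.congr fun k => by simp [hs]
  refine ⟨⟨_, hlim'⟩, ?_⟩
  have hup : Tendsto (fun k => a k + e k - a (k + 1)) atTop (𝓝 0) := by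
    have := (hlim'.add hsum.tendsto_atTop_zero).sub ((tendsto_add_atTop_iff_nat 1).2 hlim')
    simpa using this
  exact squeeze_zero hb (fun k => by linarith [h k]) hup

variable {X Y : Type*} [NormedAddCommGroup X] [InnerProductSpace ℝ X]
  [NormedAddCommGroup Y] [InnerProductSpace ℝ Y]

/-- The optimality conditions for minimizing `F x + γ (B x)` over `B x ∈ C`, with multiplier `l`:
`∇F(x) = Bᵀ l` and `-l ∈ ∂γ(B x)`, both expressed as subgradient inequalities. The inequality for
`F` includes the quadratic term of its strong convexity with parameter `μ`, so that no derivative of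
`F` is mentioned. -/
structure IsKKT (B : X →ₗ[ℝ] Y) (F : X → ℝ) (C : Set Y) (γ : Y → ℝ) (μ : ℝ) (x : X) (l : Y) :
    Prop where
  mem : B x ∈ C
  primal : ∀ z, F x + inner ℝ l (B (z - x)) + μ / 2 * ‖z - x‖ ^ 2 ≤ F z
  dual : ∀ y ∈ C, γ (B x) - inner ℝ l (y - B x) ≤ γ y

variable {B : X →ₗ[ℝ] Y} {F : X → ℝ} {C : Set Y} {γ : Y → ℝ} {μ : ℝ}

/-- One inexact step decreases the squared distance of the multiplier to any exact one, `ls`, up to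
`ε ^ 2`. -/
theorem fejer_step {xs : X} {ls : Y} (hK : IsKKT B F C γ μ xs ls) (hμ : 0 < μ) {σ ε ρ : ℝ}
    (hσ : 0 < σ) (hρ : ρ ^ 2 ≤ ε ^ 2 * μ / σ) {x : X} {y l l' : Y}
    (hF : F x + inner ℝ l' (B (xs - x)) - ρ * ‖xs - x‖ + μ / 2 * ‖xs - x‖ ^ 2 ≤ F xs)
    (hy : y ∈ C) (hγ : ∀ z ∈ C, γ y - inner ℝ l' (z - y) ≤ γ z)
    (hl : l' = l - σ • (B x - y)) :
    ‖l' - ls‖ ^ 2 + (σ * μ * ‖x - xs‖ ^ 2 + ‖l - l'‖ ^ 2) ≤ ‖l - ls‖ ^ 2 + ε ^ 2 := by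
  have h1 := hK.primal x
  have h2 := hK.dual y hy
  have h3 := hγ _ hK.mem
  rw [norm_sub_rev xs x] at hF
  have hmono : μ * ‖x - xs‖ ^ 2 - ρ * ‖x - xs‖ ≤ inner ℝ (l' - ls) (B x - y) := by
    simp only [map_sub, inner_sub_left, inner_sub_right] at *
    linarith
  have hexp : ‖l - ls‖ ^ 2 =
      ‖l' - ls‖ ^ 2 + ‖l - l'‖ ^ 2 + 2 * (σ * inner ℝ (l' - ls) (B x - y)) := by
    have e1 : l - l' = σ • (B x - y) := by rw [hl]; abel
    have e2 : l - ls = (l' - ls) + (l - l') := by abel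
    rw [e2, norm_add_sq_real, e1, inner_smul_right]
    ring
  -- Young's inequality splits the error so that half of the strong convexity term survives.
  have hquad : ρ * ‖x - xs‖ ≤ μ / 2 * ‖x - xs‖ ^ 2 + ρ ^ 2 / (2 * μ) := by
    have h : μ / 2 * ‖x - xs‖ ^ 2 + ρ ^ 2 / (2 * μ) - ρ * ‖x - xs‖ =
        (μ * ‖x - xs‖ - ρ) ^ 2 / (2 * μ) := by field_simp; ring
    have : 0 ≤ (μ * ‖x - xs‖ - ρ) ^ 2 / (2 * μ) := by positivity
    linarith
  have hε : σ * (ρ ^ 2 / (2 * μ)) ≤ ε ^ 2 / 2 := by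
    rw [le_div_iff₀ hσ] at hρ
    rw [← mul_div_assoc, div_le_div_iff₀ (by positivity) (by positivity)]
    linarith
  have h5 : σ * (μ / 2 * ‖x - xs‖ ^ 2 - ρ ^ 2 / (2 * μ)) ≤ σ * inner ℝ (l' - ls) (B x - y) :=
    mul_le_mul_of_nonneg_left (by linarith) hσ.le
  rw [hexp]
  linarith

/-- Under the optimality conditions the primal minimizer is strict. -/
theorem IsKKT.lt_of_ne {xs : X} {ls : Y} (hK : IsKKT B F C γ μ xs ls) (hμ : 0 < μ) {x : X}
    (hx : B x ∈ C) (hne : x ≠ xs) : F xs + γ (B xs) < F x + γ (B x) := by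
  have h1 := hK.primal x
  have h2 := hK.dual _ hx
  rw [map_sub] at h1
  have : 0 < ‖x - xs‖ := norm_pos_iff.2 (sub_ne_zero.2 hne)
  have : 0 < μ / 2 * ‖x - xs‖ ^ 2 := by positivity
  linarith

/-- Convergence of a sequence whose steps satisfy the optimality conditions up to the error `ρ k` in
the gradient of `F` and `(l k - l (k + 1)) / σ k` in the constraint `B x = y`. -/
theorem tendsto_of_inexact_steps [FiniteDimensional ℝ X] [FiniteDimensional ℝ Y]
    {xs : X} {ls : Y} (hK : IsKKT B F C γ μ xs ls) (hμ : 0 < μ)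
    (hFc : Continuous F) {σ ε ρ : ℕ → ℝ} (hσ : ∀ k, 0 < σ k) (hσt : Tendsto σ atTop atTop)
    (hε : ∀ k, 0 ≤ ε k) (hεs : Summable ε)
    (hρ : ∀ k, ρ k ^ 2 ≤ ε k ^ 2 * μ / σ k) {x : ℕ → X} {y l : ℕ → Y}
    (hF : ∀ k z, F (x (k + 1)) + inner ℝ (l (k + 1)) (B (z - x (k + 1)))
      - ρ k * ‖z - x (k + 1)‖ + μ / 2 * ‖z - x (k + 1)‖ ^ 2 ≤ F z)
    (hy : ∀ k, y (k + 1) ∈ C)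
    (hγ : ∀ k, ∀ z ∈ C, γ (y (k + 1)) - inner ℝ (l (k + 1)) (z - y (k + 1)) ≤ γ z)
    (hl : ∀ k, l (k + 1) = l k - σ k • (B (x (k + 1)) - y (k + 1))) :
    Tendsto x atTop (𝓝 xs) ∧ Tendsto y atTop (𝓝 (B xs)) ∧
      ∃ li, IsKKT B F C γ μ xs li ∧ Tendsto l atTop (𝓝 li) := by
  have hε2 : Summable fun k => ε k ^ 2 := by
    refine Summable.of_norm_bounded_eventually_nat hεs ?_
    filter_upwards [hεs.tendsto_atTop_zero.eventually_le_const one_pos] with k hk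
    rw [Real.norm_of_nonneg (sq_nonneg _)]
    nlinarith [hε k]
  have fejer : ∀ li, IsKKT B F C γ μ xs li →
      (∃ c, Tendsto (fun k => ‖l k - li‖ ^ 2) atTop (𝓝 c)) ∧
      Tendsto (fun k => σ k * μ * ‖x (k + 1) - xs‖ ^ 2 + ‖l k - l (k + 1)‖ ^ 2) atTop (𝓝 0) :=
    fun li hli => tendsto_of_quasi_fejer (fun k => sq_nonneg _)
      (fun k => by have := hσ k; positivity) (fun k => sq_nonneg _) hε2
      fun k => fejer_step hli hμ (hσ k) (hρ k) (hF k xs) (hy k) (hγ k) (hl k)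
  obtain ⟨⟨c, hc⟩, hb⟩ := fejer ls hK
  have hσinv : Tendsto (fun k => (σ k)⁻¹) atTop (𝓝 0) := hσt.inv_tendsto_atTop
  have hx1 : Tendsto (fun k => x (k + 1)) atTop (𝓝 xs) := by
    rw [← tendsto_sub_nhds_zero_iff]
    refine tendsto_zero_of_norm_sq (squeeze_zero (fun k => sq_nonneg _) (fun k => ?_)
      (by simpa using (hb.mul hσinv).mul_const μ⁻¹))
    have h1 := hσ k
    have h2 : ‖x (k + 1) - xs‖ ^ 2
        = σ k * μ * ‖x (k + 1) - xs‖ ^ 2 * (σ k)⁻¹ * μ⁻¹ := by field_simp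
    have h3 : 0 ≤ ‖l k - l (k + 1)‖ ^ 2 := sq_nonneg _
    calc ‖x (k + 1) - xs‖ ^ 2 = σ k * μ * ‖x (k + 1) - xs‖ ^ 2 * (σ k)⁻¹ * μ⁻¹ := h2
      _ ≤ (σ k * μ * ‖x (k + 1) - xs‖ ^ 2 + ‖l k - l (k + 1)‖ ^ 2) * (σ k)⁻¹ * μ⁻¹ := by
        gcongr
        linarith
  have hll : Tendsto (fun k => l k - l (k + 1)) atTop (𝓝 0) :=
    tendsto_zero_of_norm_sq (squeeze_zero (fun k => sq_nonneg _)
      (fun k => by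
        have h1 := hσ k
        have h2 : 0 ≤ σ k * μ * ‖x (k + 1) - xs‖ ^ 2 := by positivity
        linarith) hb)
  have hBc : Continuous B := B.continuous_of_finiteDimensional
  have hBx : Tendsto (fun k => B (x (k + 1))) atTop (𝓝 (B xs)) := (hBc.tendsto xs).comp hx1
  have hy1 : Tendsto (fun k => y (k + 1)) atTop (𝓝 (B xs)) := by
    have h1 : ∀ k, B (x (k + 1)) - (σ k)⁻¹ • (l k - l (k + 1)) = y (k + 1) := by
      intro k
      rw [hl k, sub_sub_cancel, smul_smul, inv_mul_cancel₀ (hσ k).ne', one_smul, sub_sub_cancel]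
    have := hBx.sub (hσinv.smul hll)
    simpa [h1] using this
  have hρ0 : Tendsto ρ atTop (𝓝 0) := by
    refine tendsto_zero_of_norm_sq (squeeze_zero (fun k => sq_nonneg _)
      (fun k => by simpa only [Real.norm_eq_abs, sq_abs] using hρ k) ?_)
    simpa [div_eq_mul_inv] using (hε2.tendsto_atTop_zero.mul_const μ).mul hσinv
  refine ⟨(tendsto_add_atTop_iff_nat 1).1 hx1, (tendsto_add_atTop_iff_nat 1).1 hy1, ?_⟩
  have hbdd : Bornology.IsBounded (Set.range l) := by
    obtain ⟨M, hM⟩ := hc.bddAbove_range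
    refine (Metric.isBounded_iff_subset_closedBall ls).2 ⟨Real.sqrt M, ?_⟩
    rintro _ ⟨k, rfl⟩
    rw [Metric.mem_closedBall, dist_eq_norm]
    exact Real.le_sqrt_of_sq_le (hM ⟨k, rfl⟩)
  have : ProperSpace Y := FiniteDimensional.proper_real Y
  obtain ⟨li, -, ψ, hψ, hlim⟩ := tendsto_subseq_of_bounded hbdd (x := fun k => l (k + 1))
    fun k => ⟨k + 1, rfl⟩
  have hψt := hψ.tendsto_atTop
  have hxψ := hx1.comp hψt
  have hyψ := hy1.comp hψt
  have hBψ : ∀ z, Tendsto (fun k => B (z - x (ψ k + 1))) atTop (𝓝 (B (z - xs))) := fun z =>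
    (hBc.tendsto _).comp (tendsto_const_nhds.sub hxψ)
  have hli : IsKKT B F C γ μ xs li := by
    refine ⟨hK.mem, fun z => ?_, fun z hz => ?_⟩
    · have hn : Tendsto (fun k => ‖z - x (ψ k + 1)‖) atTop (𝓝 ‖z - xs‖) :=
        (tendsto_const_nhds.sub hxψ).norm
      have h := (((((hFc.tendsto xs).comp hxψ).add (hlim.inner (𝕜 := ℝ) (hBψ z))).sub
        ((hρ0.comp hψt).mul hn)).add ((hn.pow 2).const_mul (μ / 2)))
      have := le_of_tendsto' h fun k => hF (ψ k) z
      linarith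
    -- The subgradient inequality of the exact multiplier `ls` bounds `γ (y k)` from below by a
    -- sequence with limit `γ (B xs)`, which replaces lower semicontinuity of `γ`.
    · have h1 : Tendsto (fun k => γ (B xs) - inner ℝ ls (y (ψ k + 1) - B xs)
          - inner ℝ (l (ψ k + 1)) (z - y (ψ k + 1))) atTop
          (𝓝 (γ (B xs) - inner ℝ ls (B xs - B xs) - inner ℝ li (z - B xs))) :=
        (tendsto_const_nhds.sub ((tendsto_const_nhds (x := ls)).inner (𝕜 := ℝ)
          (hyψ.sub tendsto_const_nhds))).sub
          (hlim.inner (𝕜 := ℝ) (tendsto_const_nhds.sub hyψ))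
      have h2 := le_of_tendsto' h1 fun k =>
        (show _ ≤ γ z by linarith [hK.dual _ (hy (ψ k)), hγ (ψ k) z hz])
      simpa using h2
  refine ⟨li, hli, ?_⟩
  obtain ⟨⟨c', hc'⟩, -⟩ := fejer li hli
  have h0 : Tendsto (fun k => ‖l (ψ k + 1) - li‖ ^ 2) atTop (𝓝 0) := by
    have := ((hlim.sub_const li).norm).pow 2
    simpa using this
  have hc0 : c' = 0 := tendsto_nhds_unique
    (((tendsto_add_atTop_iff_nat 1).2 hc').comp hψt) h0
  rw [← tendsto_sub_nhds_zero_iff]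
  exact tendsto_zero_of_norm_sq (hc0 ▸ hc')

end Convergence

/-! ### Convexity and intrinsic interiors for extended-real-valued functions -/

section ExtendedReal

theorem ereal_sum_ne_bot {ι : Type*} (s : Finset ι) {a : ι → EReal} (h : ∀ i ∈ s, a i ≠ ⊥) :
    ∑ i ∈ s, a i ≠ ⊥ := by
  classical
  induction s using Finset.induction_on with
  | empty => simp
  | insert i s hi ih =>
    rw [Finset.sum_insert hi]
    exact EReal.add_ne_bot_iff.2 ⟨h i (by simp), ih fun j hj => h j (by simp [hj])⟩

theorem ereal_sum_lt_top_iff {ι : Type*} (s : Finset ι) {a : ι → EReal} (h : ∀ i ∈ s, a i ≠ ⊥) :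
    ∑ i ∈ s, a i < ⊤ ↔ ∀ i ∈ s, a i < ⊤ := by
  classical
  induction s using Finset.induction_on with
  | empty => simp
  | insert i s hi ih =>
    have h1 : a i ≠ ⊥ := h i (by simp)
    have h2 : ∀ j ∈ s, a j ≠ ⊥ := fun j hj => h j (by simp [hj])
    rw [Finset.sum_insert hi, Finset.forall_mem_insert, ← ih h2, lt_top_iff_ne_top,
      EReal.add_ne_top_iff_ne_top₂ h1 (ereal_sum_ne_bot s h2), lt_top_iff_ne_top,
      lt_top_iff_ne_top]

theorem ereal_coe_sum {ι : Type*} (s : Finset ι) (a : ι → ℝ) :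
    ((∑ i ∈ s, a i : ℝ) : EReal) = ∑ i ∈ s, (a i : EReal) := by
  classical
  induction s using Finset.induction_on with
  | empty => simp
  | insert i s hi ih => rw [Finset.sum_insert hi, Finset.sum_insert hi, EReal.coe_add, ih]

theorem coe_toReal_of_mem {E : Type*} {p : E → EReal} (hbot : ∀ x, p x ≠ ⊥) {x : E}
    (hx : x ∈ effDomain p) :
    ((p x).toReal : EReal) = p x :=
  EReal.coe_toReal (ne_of_lt hx) (hbot x)

variable {E : Type*} [NormedAddCommGroup E] [InnerProductSpace ℝ E]

theorem IsClosedProperConvex.convexOn {p : E → EReal} (hp : IsClosedProperConvex p) :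
    ConvexOn ℝ (effDomain p) fun x => (p x).toReal := by
  have key : ∀ ⦃x⦄, x ∈ effDomain p → ∀ ⦃y⦄, y ∈ effDomain p → ∀ ⦃a b : ℝ⦄, 0 ≤ a → 0 ≤ b →
      a + b = 1 → p (a • x + b • y) ≤ ((a * (p x).toReal + b * (p y).toReal : ℝ) : EReal) :=
    fun x hx y hy a b ha hb hab =>
      hp.convex_epi (x := (x, (p x).toReal)) (y := (y, (p y).toReal))
        (coe_toReal_of_mem hp.ne_bot hx).ge (coe_toReal_of_mem hp.ne_bot hy).ge ha hb hab
  refine ⟨fun x hx y hy a b ha hb hab => ?_, fun x hx y hy a b ha hb hab => ?_⟩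
  · exact (key hx hy ha hb hab).trans_lt (EReal.coe_lt_top _)
  · exact (EReal.toReal_le_toReal (key hx hy ha hb hab) (hp.ne_bot _) (EReal.coe_ne_top _)).trans
      (EReal.toReal_coe _).le

/-- Segments of `s` that end at a point of its intrinsic interior can be prolonged beyond this
point. -/
theorem eventually_sub_smul_mem_of_mem_intrinsicInterior {s : Set E} {w u : E}
    (hw : w ∈ intrinsicInterior ℝ s) (hu : u ∈ s) :
    ∀ᶠ c : ℝ in 𝓝[>] 0, w - c • (u - w) ∈ s := by
  obtain ⟨w', hw', rfl⟩ := mem_intrinsicInterior.1 hw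
  have hmem : ∀ c : ℝ, (w' : E) - c • (u - w') ∈ affineSpan ℝ s := fun c => by
    have := AffineMap.lineMap_mem (-c) w'.2 (subset_affineSpan ℝ s hu)
    rw [AffineMap.lineMap_apply] at this
    convert this using 1
    simp only [vsub_eq_sub, vadd_eq_add, neg_smul]
    abel
  let q : ℝ → affineSpan ℝ s := fun c => ⟨(w' : E) - c • (u - w'), hmem c⟩
  have hq : Continuous q := by
    refine Continuous.subtype_mk ?_ _
    fun_prop
  have hq0 : q 0 = w' := by ext; simp [q]
  have h : ∀ᶠ c in 𝓝 (0 : ℝ), q c ∈ ((↑) ⁻¹' s : Set (affineSpan ℝ s)) :=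
    hq.continuousAt.eventually_mem (by rw [hq0]; exact mem_interior_iff_mem_nhds.1 hw')
  exact h.filter_mono nhdsWithin_le_nhds

end ExtendedReal

/-! ### The functions and the operator of the consensus problem -/

section Consensus

variable {m n : ℕ}

theorem mem_effDomain_objG {g : Fin m → Agent n → EReal} (hg : ∀ i x, g i x ≠ ⊥)
    {y : Stack2 m n} : y ∈ effDomain (objG g) ↔
      (∀ i, topBlock y i ∈ effDomain (g i)) ∧ ∀ r, y (Sum.inr r) = 0 := by
  have hs : ∑ i, g i (topBlock y i) ≠ ⊥ := ereal_sum_ne_bot _ fun i _ => hg i _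
  have h : (∑ i, g i (topBlock y i) < ⊤) ↔ ∀ i, topBlock y i ∈ effDomain (g i) := by
    rw [ereal_sum_lt_top_iff _ fun i _ => hg i _]
    simp [effDomain]
  rw [← h]
  change objG g y < ⊤ ↔ _
  by_cases h0 : ∀ r, y (Sum.inr r) = 0
  · rw [objG, if_pos h0, add_zero, and_iff_left h0]
  · rw [objG, if_neg h0, EReal.add_top_of_ne_bot hs]
    exact iff_of_false (lt_irrefl _) fun h' => h0 h'.2

theorem objG_ne_bot {g : Fin m → Agent n → EReal} (hg : ∀ i x, g i x ≠ ⊥) (y : Stack2 m n) :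
    objG g y ≠ ⊥ := by
  refine EReal.add_ne_bot_iff.2 ⟨ereal_sum_ne_bot _ fun i _ => hg i _, ?_⟩
  split_ifs <;> simp

theorem toReal_objG {g : Fin m → Agent n → EReal} (hg : ∀ i x, g i x ≠ ⊥) {y : Stack2 m n}
    (hy : y ∈ effDomain (objG g)) : (objG g y).toReal = ∑ i, (g i (topBlock y i)).toReal := by
  obtain ⟨h1, h2⟩ := (mem_effDomain_objG hg).1 hy
  rw [objG, if_pos h2, add_zero,
    Finset.sum_congr rfl fun i _ => (coe_toReal_of_mem (hg i) (h1 i)).symm, ← ereal_coe_sum,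
    EReal.toReal_coe]

theorem topBlock_add_smul (a b : ℝ) (y z : Stack2 m n) (i : Fin m) :
    topBlock (a • y + b • z) i = a • topBlock y i + b • topBlock z i := by
  ext j; simp [topBlock]

theorem convexOn_objG {g : Fin m → Agent n → EReal} (hg : ∀ i, IsClosedProperConvex (g i)) :
    ConvexOn ℝ (effDomain (objG g)) fun y => (objG g y).toReal := by
  have hbot : ∀ i x, g i x ≠ ⊥ := fun i => (hg i).ne_bot
  have hconv : Convex ℝ (effDomain (objG g)) := by
    intro y hy z hz a b ha hb hab
    rw [mem_effDomain_objG hbot] at hy hz ⊢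
    refine ⟨fun i => ?_, fun r => by simp [hy.2 r, hz.2 r]⟩
    rw [topBlock_add_smul]
    exact (hg i).convexOn.1 (hy.1 i) (hz.1 i) ha hb hab
  refine ⟨hconv, fun y hy z hz a b ha hb hab => ?_⟩
  have hyz := hconv hy hz ha hb hab
  simp only [toReal_objG hbot hy, toReal_objG hbot hz, toReal_objG hbot hyz, Finset.smul_sum,
    ← Finset.sum_add_distrib, topBlock_add_smul]
  rw [mem_effDomain_objG hbot] at hy hz
  exact Finset.sum_le_sum fun i _ => (hg i).convexOn.2 (hy.1 i) (hz.1 i) ha hb hab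

/-- The projection `x ↦ x_i` of a stacked vector to one block, as a continuous linear map. -/
noncomputable def blockCLM (i : Fin m) : Stack m n →L[ℝ] Agent n :=
  LinearMap.toContinuousLinearMap
    { toFun := fun x => block x i
      map_add' := fun x y => by ext j; simp [block]
      map_smul' := fun c x => by ext j; simp [block] }

@[simp] theorem blockCLM_apply (i : Fin m) (x : Stack m n) : blockCLM i x = block x i := rfl

theorem norm_sq_eq_sum_block (x : Stack m n) : ‖x‖ ^ 2 = ∑ i, ‖block x i‖ ^ 2 := by
  simp only [EuclideanSpace.norm_sq_eq, block, Fintype.sum_prod_type]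

theorem differentiable_objF {f : Fin m → Agent n → ℝ} (hf : ∀ i, Differentiable ℝ (f i)) :
    Differentiable ℝ (objF f) := by
  unfold objF
  exact Differentiable.fun_sum fun i _ => (hf i).comp (blockCLM i).differentiable

theorem fderiv_objF {f : Fin m → Agent n → ℝ} (hf : ∀ i, Differentiable ℝ (f i))
    (x d : Stack m n) :
    fderiv ℝ (objF f) x d = ∑ i, inner ℝ (gradient (f i) (block x i)) (block d i) := by
  have h : HasFDerivAt (objF f)
      (∑ i, (fderiv ℝ (f i) (block x i)).comp (blockCLM i)) x := by
    unfold objF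
    exact HasFDerivAt.fun_sum fun i _ =>
      ((hf i) (block x i)).hasFDerivAt.comp x (blockCLM i).hasFDerivAt
  rw [h.fderiv]
  simp [gradient]

theorem objF_strong_convexity {f : Fin m → Agent n → ℝ} {μ : Fin m → ℝ}
    (hf : ∀ i, IsStronglyConvex (μ i) (f i)) (x z : Stack m n) :
    objF f x + fderiv ℝ (objF f) x (z - x) + (⨅ i, μ i) / 2 * ‖z - x‖ ^ 2 ≤ objF f z := by
  rw [fderiv_objF fun i => (hf i).2.1, norm_sq_eq_sum_block, Finset.mul_sum]
  unfold objF
  rw [← Finset.sum_add_distrib, ← Finset.sum_add_distrib]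
  refine Finset.sum_le_sum fun i _ => ?_
  have h := (hf i).2.2 (block x i) (block z i)
  have hμ : (⨅ i, μ i) ≤ μ i := ciInf_le (Set.finite_range μ).bddBelow i
  have hb : block (z - x) i = block z i - block x i := rfl
  rw [hb]
  refine le_trans ?_ h
  gcongr

theorem inner_opBT (L : Matrix (Fin m) (Fin m) ℝ) (l : Stack2 m n) (x : Stack m n) :
    inner ℝ x (opBT n L l) = inner ℝ l (opB n L x) := by
  have h := Matrix.toEuclideanLin_conjTranspose_eq_adjoint (𝕜 := ℝ) (matB n L)
  rw [Matrix.conjTranspose_eq_transpose_of_trivial] at h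
  rw [opBT, h, LinearMap.adjoint_inner_right, real_inner_comm]
  rfl

theorem topBlock_opB (L : Matrix (Fin m) (Fin m) ℝ) (x : Stack m n) (i : Fin m) :
    topBlock (opB n L x) i = block x i := by
  ext j
  simp [topBlock, block, opB, matB, Matrix.fromRows_mulVec]

/-- A stack of identical blocks is annihilated by `W = L ⊗ I`, as `L` annihilates constant vectors.
-/
theorem opB_const_inr {𝒢 : SimpleGraph (Fin m)} {L : Matrix (Fin m) (Fin m) ℝ}
    (hL : IsGossipMatrix 𝒢 L) (w : Agent n) (r : Fin m × Fin n) :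
    opB n L (WithLp.toLp 2 fun q => w q.2) (Sum.inr r) = 0 := by
  have h1 : (fun _ => 1 : Fin m → ℝ) ∈ LinearMap.ker L.mulVecLin := by
    rw [hL.null_eq]; exact Submodule.mem_span_singleton_self _
  have h2 : ∑ i, L r.1 i = 0 := by
    have := congrFun (LinearMap.mem_ker.1 h1) r.1
    simpa [Matrix.mulVec, dotProduct] using this
  simp [opB, matB, gossipW, Matrix.mulVec, dotProduct, Fintype.sum_prod_type,
    Matrix.kroneckerMap_apply, Matrix.one_apply, ← Finset.sum_mul, h2]

end Consensus

/-! ### Optimality conditions and inexact steps for the consensus problem -/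

section Method

variable {m n : ℕ}

variable {f : Fin m → Agent n → ℝ} {g : Fin m → Agent n → EReal}
  {L : Matrix (Fin m) (Fin m) ℝ}

theorem coe_add_objG (hg : ∀ i x, g i x ≠ ⊥) (r : ℝ) {y : Stack2 m n}
    (hy : y ∈ effDomain (objG g)) :
    (r : EReal) + objG g y = ((r + (objG g y).toReal : ℝ) : EReal) := by
  rw [EReal.coe_add, coe_toReal_of_mem (objG_ne_bot hg) hy]

theorem objG_eq_top {y : Stack2 m n} (hy : y ∉ effDomain (objG g)) : objG g y = ⊤ :=
  not_lt_top_iff.1 hy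

theorem isPrimalSolution_iff (hg : ∀ i x, g i x ≠ ⊥) {x : Stack m n} {y : Stack2 m n} :
    IsPrimalSolution f g L x y ↔ opB n L x = y ∧ y ∈ effDomain (objG g) ∧
      ∀ x', opB n L x' ∈ effDomain (objG g) →
        objF f x + (objG g y).toReal ≤ objF f x' + (objG g (opB n L x')).toReal := by
  constructor
  · rintro ⟨hxy, hfin, hmin⟩
    have hy : y ∈ effDomain (objG g) := by
      by_contra h
      rw [objG_eq_top h, EReal.coe_add_top] at hfin
      exact lt_irrefl _ hfin
    refine ⟨hxy, hy, fun x' hx' => ?_⟩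
    have h := hmin x' _ rfl
    rwa [coe_add_objG hg _ hy, coe_add_objG hg _ hx', EReal.coe_le_coe_iff] at h
  · rintro ⟨hxy, hy, hmin⟩
    refine ⟨hxy, ?_, ?_⟩
    · rw [coe_add_objG hg _ hy]
      exact EReal.coe_lt_top _
    · rintro x' _ rfl
      by_cases hx' : opB n L x' ∈ effDomain (objG g)
      · rw [coe_add_objG hg _ hy, coe_add_objG hg _ hx', EReal.coe_le_coe_iff]
        exact hmin x' hx'
      · rw [objG_eq_top hx', EReal.coe_add_top]
        exact le_top

/-- The constraint qualification in the form required by `exists_multiplier`; the point is the stack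
of copies of a common point of the intrinsic interiors. -/
theorem exists_core_point {𝒢 : SimpleGraph (Fin m)} (hL : IsGossipMatrix 𝒢 L)
    (hg : ∀ i x, g i x ≠ ⊥)
    (hri : ∃ w, ∀ i, w ∈ intrinsicInterior ℝ (effDomain (g i))) :
    ∃ x₀, ∀ y ∈ effDomain (objG g), ∃ c : ℝ, 0 < c ∧
      opB n L x₀ - c • (y - opB n L x₀) ∈ effDomain (objG g) := by
  obtain ⟨w, hw⟩ := hri
  refine ⟨WithLp.toLp 2 fun q => w q.2, fun y hy => ?_⟩
  rw [mem_effDomain_objG hg] at hy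
  have hev : ∀ᶠ c : ℝ in 𝓝[>] 0, ∀ i, w - c • (topBlock y i - w) ∈ effDomain (g i) :=
    eventually_all.2 fun i => eventually_sub_smul_mem_of_mem_intrinsicInterior (hw i) (hy.1 i)
  obtain ⟨c, hc, hc0⟩ := (hev.and self_mem_nhdsWithin).exists
  refine ⟨c, hc0, (mem_effDomain_objG hg).2 ⟨fun i => ?_, fun r => ?_⟩⟩
  · convert hc i using 1
    have h := topBlock_opB (n := n) L (WithLp.toLp 2 fun q => w q.2) i
    ext j
    have hj : opB n L (WithLp.toLp 2 fun q => w q.2) (Sum.inl (i, j)) = w j :=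
      congrFun (congrArg WithLp.ofLp h) j
    simp [topBlock, hj]
  · simp [opB_const_inr hL w r, hy.2 r]

theorem exists_isKKT {𝒢 : SimpleGraph (Fin m)} (hL : IsGossipMatrix 𝒢 L) {μ : Fin m → ℝ}
    (hf : ∀ i, IsStronglyConvex (μ i) (f i)) (hg : ∀ i, IsClosedProperConvex (g i))
    (hri : ∃ w, ∀ i, w ∈ intrinsicInterior ℝ (effDomain (g i)))
    {x : Stack m n} {y : Stack2 m n} (hxy : IsPrimalSolution f g L x y) :
    ∃ l, IsKKT (opB n L) (objF f) (effDomain (objG g)) (fun y => (objG g y).toReal) (⨅ i, μ i)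
      x l := by
  have hbot : ∀ i x, g i x ≠ ⊥ := fun i => (hg i).ne_bot
  obtain ⟨rfl, hy, hmin⟩ := (isPrimalSolution_iff hbot).1 hxy
  obtain ⟨x₀, hx₀⟩ := exists_core_point hL hbot hri
  have hF : HasFDerivAt (objF f) (fderiv ℝ (objF f) x) x :=
    (differentiable_objF (fun i => (hf i).2.1) x).hasFDerivAt
  obtain ⟨l, hl, hl'⟩ := exists_multiplier (convexOn_objG hg) (opB n L)
    (fderiv ℝ (objF f) x : Stack m n →ₗ[ℝ] ℝ) hy
    (fun z hz => first_order_of_isMin (convexOn_objG hg) (opB n L) hF hy hmin hz) hx₀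
  refine ⟨l, hy, fun z => ?_, hl'⟩
  rw [← hl]
  exact objF_strong_convexity hf x z

/-- The optimality conditions determine the dual value to be `-F(x) - G(B x)`, which is a lower
bound for the dual objective by weak duality. -/
theorem IsKKT.isDualSolution (hg : ∀ i x, g i x ≠ ⊥) {μ : ℝ} (hμ : 0 ≤ μ)
    {x : Stack m n} {l : Stack2 m n}
    (hK : IsKKT (opB n L) (objF f) (effDomain (objG g)) (fun y => (objG g y).toReal) μ x l) :
    IsDualSolution f g L l := by
  set γ : ℝ := (objG g (opB n L x)).toReal with hγ
  have hG : objG g (opB n L x) = γ := (coe_toReal_of_mem (objG_ne_bot hg) hK.mem).symm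
  have hF : conjugate (fun x => (objF f x : EReal)) (opBT n L l)
      ≤ ((inner ℝ l (opB n L x) - objF f x : ℝ) : EReal) := by
    refine iSup_le fun z => ?_
    rw [inner_opBT, ← EReal.coe_sub, EReal.coe_le_coe_iff]
    have h := hK.primal z
    rw [map_sub, inner_sub_right] at h
    have : 0 ≤ μ / 2 * ‖z - x‖ ^ 2 := by positivity
    linarith
  have hG' : conjugate (objG g) (-l) ≤ ((-inner ℝ l (opB n L x) - γ : ℝ) : EReal) := by
    refine iSup_le fun y => ?_
    by_cases hy : y ∈ effDomain (objG g)
    · rw [← coe_toReal_of_mem (objG_ne_bot hg) hy, ← EReal.coe_sub, EReal.coe_le_coe_iff,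
        inner_neg_right, real_inner_comm]
      have h := hK.dual y hy
      simp only [inner_sub_right] at h
      linarith
    · rw [objG_eq_top hy, EReal.sub_top]
      exact bot_le
  have hup : dualH f g L l ≤ ((-objF f x - γ : ℝ) : EReal) := by
    refine (add_le_add hF hG').trans_eq ?_
    rw [← EReal.coe_add]
    congr 1
    ring
  refine ⟨hup.trans_lt (EReal.coe_lt_top _), fun l' => hup.trans ?_⟩
  have h1 : ((inner ℝ l' (opB n L x) - objF f x : ℝ) : EReal)
      ≤ conjugate (fun x => (objF f x : EReal)) (opBT n L l') := by
    refine le_trans (le_of_eq ?_) (le_iSup _ x)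
    rw [inner_opBT, ← EReal.coe_sub]
  have h2 : ((-inner ℝ l' (opB n L x) - γ : ℝ) : EReal) ≤ conjugate (objG g) (-l') := by
    refine le_trans (le_of_eq ?_) (le_iSup _ (opB n L x))
    rw [hG, ← EReal.coe_sub, inner_neg_right, real_inner_comm]
  refine le_trans (le_of_eq ?_) (add_le_add h1 h2)
  rw [← EReal.coe_add]
  congr 1
  ring

/-- Points of the proximal set lie in the effective domain, and there they minimize the real-valued
proximal objective. -/
theorem mem_of_mem_proxSet {Y : Type*} [NormedAddCommGroup Y] {p : Y → EReal}
    (hbot : ∀ x, p x ≠ ⊥) (hne : (effDomain p).Nonempty) {σ : ℝ} (hσ : 0 < σ) {v y : Y}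
    (hy : y ∈ proxSet (fun y => ((σ⁻¹ : ℝ) : EReal) * p y) v) :
    y ∈ effDomain p ∧ ∀ z ∈ effDomain p,
      (p y).toReal + σ / 2 * ‖y - v‖ ^ 2 ≤ (p z).toReal + σ / 2 * ‖z - v‖ ^ 2 := by
  have hval : ∀ z ∈ effDomain p, ((σ⁻¹ : ℝ) : EReal) * p z + ((‖z - v‖ ^ 2 / 2 : ℝ) : EReal)
      = ((σ⁻¹ * (p z).toReal + ‖z - v‖ ^ 2 / 2 : ℝ) : EReal) := fun z hz => by
    rw [EReal.coe_add, EReal.coe_mul, coe_toReal_of_mem hbot hz]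
  have hmem : y ∈ effDomain p := by
    obtain ⟨z, hz⟩ := hne
    by_contra h
    have h1 := hy z
    simp only at h1
    rw [hval z hz, not_lt_top_iff.1 (show ¬ p y < ⊤ from h),
      EReal.coe_mul_top_of_pos (inv_pos.2 hσ), EReal.top_add_coe] at h1
    exact absurd h1 (not_le.2 (EReal.coe_lt_top _))
  refine ⟨hmem, fun z hz => ?_⟩
  have h1 := hy z
  simp only at h1
  rw [hval z hz, hval y hmem, EReal.coe_le_coe_iff] at h1
  have h2 := mul_le_mul_of_nonneg_left h1 hσ.le
  simp only [mul_add, mul_inv_cancel_left₀ hσ.ne'] at h2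
  linarith

/-- The value of `phi` is the infimum of the real values of the augmented Lagrangian, as soon as
these are bounded below: then the `toReal` in its definition is applied to a finite number. -/
theorem isGLB_phi (hg : ∀ i x, g i x ≠ ⊥) (hne : (effDomain (objG g)).Nonempty) (σ : ℝ)
    (l : Stack2 m n) (x : Stack m n)
    (hbdd : BddBelow ((fun z => objF f x + (objG g z).toReal +
      (σ / 2 * ‖opB n L x - z - σ⁻¹ • l‖ ^ 2 - ‖l‖ ^ 2 / (2 * σ))) '' effDomain (objG g))) :
    IsGLB ((fun z => objF f x + (objG g z).toReal +
      (σ / 2 * ‖opB n L x - z - σ⁻¹ • l‖ ^ 2 - ‖l‖ ^ 2 / (2 * σ))) '' effDomain (objG g))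
      (phi f g L σ l x) := by
  set Φ : Stack2 m n → ℝ := fun z => objF f x + (objG g z).toReal +
    (σ / 2 * ‖opB n L x - z - σ⁻¹ • l‖ ^ 2 - ‖l‖ ^ 2 / (2 * σ)) with hΦ
  have hval : ∀ z ∈ effDomain (objG g), augLagrangian f g L σ x z l = (Φ z : EReal) :=
    fun z hz => by rw [hΦ, augLagrangian, coe_add_objG hg _ hz, ← EReal.coe_add]
  have hlow : ∀ a : ℝ, a ∈ lowerBounds (Φ '' effDomain (objG g)) →
      (a : EReal) ≤ ⨅ z, augLagrangian f g L σ x z l := by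
    intro a ha
    refine le_iInf fun z => ?_
    by_cases hz : z ∈ effDomain (objG g)
    · rw [hval z hz, EReal.coe_le_coe_iff]
      exact ha ⟨z, hz, rfl⟩
    · rw [augLagrangian, objG_eq_top hz, EReal.coe_add_top, EReal.top_add_coe]
      exact le_top
  have hup : ∀ z ∈ effDomain (objG g), ⨅ z, augLagrangian f g L σ x z l ≤ (Φ z : EReal) :=
    fun z hz => (iInf_le _ z).trans_eq (hval z hz)
  have hcoe : ((phi f g L σ l x : ℝ) : EReal) = ⨅ z, augLagrangian f g L σ x z l := by
    obtain ⟨a, ha⟩ := hbdd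
    obtain ⟨z, hz⟩ := hne
    exact EReal.coe_toReal (ne_of_lt ((hup z hz).trans_lt (EReal.coe_lt_top _)))
      (ne_of_gt ((EReal.bot_lt_coe a).trans_le (hlow a ha)))
  constructor
  · rintro _ ⟨z, hz, rfl⟩
    rw [← EReal.coe_le_coe_iff, hcoe]
    exact hup z hz
  · intro a ha
    rw [← EReal.coe_le_coe_iff, hcoe]
    exact hlow a ha

/-- A step of the inexact method satisfies the optimality conditions up to an error in the gradient
of `F`, which is exactly the norm of the gradient of the reduced function `φ`. -/
theorem inexact_step {μ : Fin m → ℝ} (hf : ∀ i, IsStronglyConvex (μ i) (f i))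
    (hg : ∀ i, IsClosedProperConvex (g i)) (hne : (effDomain (objG g)).Nonempty)
    {σ : ℝ} (hσ : 0 < σ) {x : Stack m n} {y l l' : Stack2 m n}
    (hy : y ∈ proxSet (fun y => ((σ⁻¹ : ℝ) : EReal) * objG g y) (opB n L x - σ⁻¹ • l))
    (hl : l' = l - σ • (opB n L x - y)) :
    y ∈ effDomain (objG g) ∧
    (∀ z ∈ effDomain (objG g),
      (objG g y).toReal - inner ℝ l' (z - y) ≤ (objG g z).toReal) ∧
    ∀ z, objF f x + inner ℝ l' (opB n L (z - x))
      - ‖gradient (phi f g L σ l) x‖ * ‖z - x‖ + (⨅ i, μ i) / 2 * ‖z - x‖ ^ 2 ≤ objF f z := by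
  have hbot : ∀ i x, g i x ≠ ⊥ := fun i => (hg i).ne_bot
  obtain ⟨hmem, hmin⟩ := mem_of_mem_proxSet (objG_ne_bot hbot) hne hσ hy
  have hsub := subgradient_of_isMin_prox (convexOn_objG hg) hmem hmin
  have hs : σ • (opB n L x - σ⁻¹ • l - y) = -l' := by
    rw [hl, smul_sub, smul_sub, smul_smul, mul_inv_cancel₀ hσ.ne', one_smul, smul_sub]
    abel
  have hφ := hasFDerivAt_envelope hσ
    (differentiable_objF (fun i => (hf i).2.1) x).hasFDerivAt hmem hsub
    (fun x' hx' => isGLB_phi (L := L) hbot hne σ l x' hx')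
  refine ⟨hmem, fun z hz => ?_, fun z => ?_⟩
  · have h := hsub z hz
    rw [hs, inner_neg_left] at h
    linarith
  · have h1 : inner ℝ (gradient (phi f g L σ l) x) (z - x)
        = fderiv ℝ (objF f) x (z - x) - inner ℝ l' (opB n L (z - x)) := by
      rw [gradient, InnerProductSpace.toDual_symm_apply, hφ.fderiv, hs]
      simp [sub_eq_add_neg]
    have h2 := (abs_le.1 (abs_real_inner_le_norm (gradient (phi f g L σ l) x) (z - x))).1
    have h3 := objF_strong_convexity hf x z
    linarith

end Method

end ConsensusALM

theorem mainTheorem1 {m n : ℕ}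
    (𝒢 : SimpleGraph (Fin m)) (h𝒢 : 𝒢.Connected)
    (L : Matrix (Fin m) (Fin m) ℝ) (hL : ConsensusALM.IsGossipMatrix 𝒢 L)
    (f : Fin m → ConsensusALM.Agent n → ℝ) (g : Fin m → ConsensusALM.Agent n → EReal)
    (μ Lf : Fin m → ℝ)
    (hf_sc : ∀ i, ConsensusALM.IsStronglyConvex (μ i) (f i))
    (hf_smooth : ∀ i, ConsensusALM.IsLSmooth (Lf i) (f i))
    (hg : ∀ i, ConsensusALM.IsClosedProperConvex (g i))
    (hsol : ∃ x y, ConsensusALM.IsPrimalSolution f g L x y)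
    (hri : ∃ w, ∀ i, w ∈ intrinsicInterior ℝ (ConsensusALM.effDomain (g i)))
    (σ ε : ℕ → ℝ) (x : ℕ → ConsensusALM.Stack m n) (y lam : ℕ → ConsensusALM.Stack2 m n)
    (hALM : ConsensusALM.IsInexactALM f g L (⨅ i, μ i) σ ε x y lam) :
    (∃ xs ys, (∀ x' y', ConsensusALM.IsPrimalSolution f g L x' y' ↔ x' = xs ∧ y' = ys) ∧
      Tendsto x atTop (𝓝 xs) ∧ Tendsto y atTop (𝓝 ys)) ∧
    ∃ lams, ConsensusALM.IsDualSolution f g L lams ∧ Tendsto lam atTop (𝓝 lams) := by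
  open ConsensusALM in
  have hbot : ∀ i x, g i x ≠ ⊥ := fun i => (hg i).ne_bot
  have : Nonempty (Fin m) := h𝒢.nonempty
  have hμ : 0 < ⨅ i, μ i := by
    obtain ⟨i, hi⟩ := exists_eq_ciInf_of_finite (f := μ)
    exact hi ▸ (hf_sc i).1
  obtain ⟨xs, ys, hxs⟩ := hsol
  obtain ⟨ls, hK⟩ := exists_isKKT hL hf_sc hg hri hxs
  obtain ⟨rfl, hys, -⟩ := (isPrimalSolution_iff hbot).1 hxs
  have step := fun k => inexact_step hf_sc hg ⟨_, hys⟩ (hALM.sigma_pos k) (hALM.prox_step k)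
    (hALM.multiplier_step k)
  obtain ⟨hx, hy, li, hli, hlim⟩ := tendsto_of_inexact_steps hK hμ
    (differentiable_objF fun i => (hf_sc i).2.1).continuous hALM.sigma_pos hALM.sigma_tendsto
    hALM.eps_nonneg hALM.eps_summable hALM.criterion (fun k => (step k).2.2)
    (fun k => (step k).1) (fun k => (step k).2.1) hALM.multiplier_step
  refine ⟨⟨xs, opB n L xs, fun x' y' => ⟨fun h => ?_, ?_⟩, hx, hy⟩,
    li, hli.isDualSolution hbot hμ.le, hlim⟩
  · obtain ⟨rfl, hy', hmin⟩ := (isPrimalSolution_iff hbot).1 h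
    have hx' : x' = xs := by
      by_contra hne
      exact absurd (hmin xs hys) (not_le.2 (hK.lt_of_ne hμ hy' hne))
    exact ⟨hx', by rw [hx']⟩
  · rintro ⟨rfl, rfl⟩
    exact hxs
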